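/- Let $[n]=\{1,\dots,n\}$. Let $D$ be a digraph (loops allowed) with vertex set $[n]$ and let $s=(s_1,\dots,s_m)\in[n]^m$. Drivers $1,\dots,m$ enter $D$ one after another. Driver $i$ starts at $s_i$; whenever her current vertex is unoccupied she parks there, and whenever it is occupied she chooses an out-neighbour of it and drives there. The sequence $s$ is a \emph{parking function on $D$} if the drivers can make their choices so that all $m$ of them park, and $P(D,m)$ denotes the number of parking functions $s\in[n]^m$ on $D$. A \emph{source tree} on $[n]$ is a digraph obtained from a rooted tree with vertex set $[n]$ by orienting every edge away from the root; $\widetilde{\mathcal T}_n$ is the set of all of them. The \emph{inverse mapping digraph} of $f:[n]\to[n]$ is the digraph $\widetilde M_f$ with vertex set $[n]$ and edge set $\{(f(i),i): i\in[n]\}$; $\widetilde{\mathcal M}_n$ is the set of all of them. Put \[ \widetilde F_{n,m}=\sum_{D\in\widetilde{\mathcal T}_n}P(D,m),\qquad \widetilde M_{n,m}=\sum_{D\in\widetilde{\mathcal M}_n}P(D,m). \] Theorem. For every $n\ge 1$, \[ n\cdot\widetilde F_{n,n}=\widetilde M_{n,n}. \] -/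

import Mathlib

namespace DigraphParking

/-- `Drives D O u v`: in the digraph `D`, when `O` is the set of occupied vertices, a driver who is
currently at `u` can end up parking at `v`: if `u` is unoccupied she parks there, and if `u` is
occupied she drives along some edge leaving `u` and continues from its head. -/
inductive Drives {V : Type*} (D : Digraph V) (O : Set V) : V → V → Prop
  | park {v : V} (hv : v ∉ O) : Drives D O v v
  | drive {u w v : V} (hu : u ∈ O) (huw : D.Adj u w) (hw : Drives D O w v) : Drives D O u v

/-- `s` is a parking function on `D`: the drivers can make their choices so that all of them park.
Here `p i` is the vertex in which driver `i` parks; the vertices occupied when she enters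
are the `p j` with `j < i`. -/
def IsParkingFunction {V : Type*} {m : ℕ} (D : Digraph V) (s : Fin m → V) : Prop :=
  ∃ p : Fin m → V, ∀ i : Fin m, Drives D {v | ∃ j : Fin m, j < i ∧ p j = v} (s i) (p i)

/-- The number of parking functions with `m` drivers on `D`. -/
noncomputable def numParking {V : Type*} (D : Digraph V) (m : ℕ) : ℕ :=
  Set.ncard {s : Fin m → V | IsParkingFunction D s}

/-- The digraph with all edge orientations reversed. -/
def reverse {V : Type*} (D : Digraph V) : Digraph V where
  Adj u v := D.Adj v u

/-- The graph `G` with each edge oriented towards the vertex `r`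
(meant for a tree `G` with root `r`). -/
def orientTowards {V : Type*} (G : SimpleGraph V) (r : V) : Digraph V where
  Adj u v := G.Adj u v ∧ G.dist r u = G.dist r v + 1

/-- The rooted sink trees with vertex set `Fin n`: rooted trees with all edges oriented
towards the root. -/
def sinkTrees (n : ℕ) : Set (Digraph (Fin n)) :=
  {D | ∃ (G : SimpleGraph (Fin n)) (r : Fin n), G.IsTree ∧ D = orientTowards G r}

/-- The rooted source trees with vertex set `Fin n`: the reversals of the sink trees. -/
def sourceTrees (n : ℕ) : Set (Digraph (Fin n)) :=
  reverse '' sinkTrees n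

/-- The mapping digraph of `f`, with an edge from `i` to `f i` for each `i`. -/
def mappingDigraph {V : Type*} (f : V → V) : Digraph V where
  Adj u v := f u = v

/-- The mapping digraphs with vertex set `Fin n`. -/
def mappingDigraphs (n : ℕ) : Set (Digraph (Fin n)) :=
  Set.range mappingDigraph

/-- The inverse mapping digraphs with vertex set `Fin n`: the reversals of the mapping digraphs. -/
def inverseMappingDigraphs (n : ℕ) : Set (Digraph (Fin n)) :=
  reverse '' mappingDigraphs n

/-- The total number of parking functions with `m` drivers on source trees with `n` vertices. -/
noncomputable def sourceTreeTotal (n m : ℕ) : ℕ :=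
  ∑ D ∈ (Set.toFinite (sourceTrees n)).toFinset, numParking D m

/-- The total number of parking functions with `m` drivers on inverse mapping digraphs with
`n` vertices. -/
noncomputable def inverseMappingTotal (n m : ℕ) : ℕ :=
  ∑ D ∈ (Set.toFinite (inverseMappingDigraphs n)).toFinset, numParking D m

end DigraphParking

/-! Fix `s` and count digraphs instead of sequences. In both families a digraph is encoded by a
parent map `f`, with edges from `f v` to `v`. A driver may be rerouted to the first free vertex on
her way, so parking is a matching problem, and by Hall's theorem it is solvable iff for each `v` no
more drivers start among the descendants of `v` than there are vertices there. With `w v` = (drivers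
starting at `v`) - 1 this is `DescNonpos f w`; for `m = n` the total of `w` is zero.

It remains to show, for each `w` of total zero, that pairs of a tree map and a marked vertex are
equinumerous with all maps, both subject to `DescNonpos` (`card_mul_card_isTreeMap`). This is a
weighted Joyal bijection. Cutting a marked tree along the path from the mark to the root leaves a
forest with an enumeration of its roots; cutting a map at its periodic points leaves a forest with a
permutation of its roots. By `descNonpos_graft_iff` the condition splits into one on the forest
alone and one on the roots, each weighted by its whole tree: partial sums along the enumeration,
respectively cycle sums of the permutation, are nonpositive.

So for weights of total zero these enumerations must be as numerous as these permutations
(`nonempty_goodList_equiv_goodPerm`). Pick `x` of nonpositive weight, delete it and add its weight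
to its successor. The condition survives on both sides; if `x` has no successor (last in the list,
or a fixed point), total zero forces its weight to be zero. The choices of successor agree, and
induction applies. -/

namespace DigraphParking

open Relation

/-! ### Parking as an injective matching into reachable vertices. -/

section Reachability

variable {V : Type*} {D : Digraph V} {O : Set V}

lemma Drives.notMem {u v : V} (h : Drives D O u v) : v ∉ O := by
  induction h with
  | park hv => exact hv
  | drive _ _ _ ih => exact ih

lemma Drives.reflTransGen {u v : V} (h : Drives D O u v) : ReflTransGen D.Adj u v := by
  induction h with
  | park hv => exact .refl
  | drive _ huw _ ih => exact .head huw ih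

/-- A driver heading for the free vertex `v` parks at the first free vertex of her route, from which
`v` is still reachable. -/
lemma exists_drives_of_reflTransGen {u v : V} (h : ReflTransGen D.Adj u v) (hv : v ∉ O) :
    ∃ w, Drives D O u w ∧ ReflTransGen D.Adj w v := by
  induction h using ReflTransGen.head_induction_on with
  | refl => exact ⟨v, .park hv, .refl⟩
  | @head a c hac hcv ih =>
    by_cases ha : a ∈ O
    · obtain ⟨w, hw, hwv⟩ := ih
      exact ⟨w, .drive ha hac hw, hwv⟩
    · exact ⟨a, .park ha, .head hac hcv⟩

/-- A sequence is a parking function as soon as the drivers can be matched injectively with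
vertices reachable from their starting points. -/
lemma isParkingFunction_iff_exists_injective {m : ℕ} (s : Fin m → V) :
    IsParkingFunction D s ↔
      ∃ p : Fin m → V, Function.Injective p ∧ ∀ i, ReflTransGen D.Adj (s i) (p i) := by
  classical
  constructor
  · rintro ⟨p, hp⟩
    refine ⟨p, fun i j hij => ?_, fun i => (hp i).reflTransGen⟩
    by_contra hne
    rcases lt_or_gt_of_ne hne with h | h
    · exact (hp j).notMem ⟨i, h, hij⟩
    · exact (hp i).notMem ⟨j, h, hij.symm⟩
  · rintro ⟨p₀, hp₀, hr₀⟩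
    -- The matching is corrected one driver at a time, so that the first `k` drivers really park
    -- where it sends them.
    have key : ∀ k : ℕ, ∃ p : Fin m → V, Function.Injective p ∧
        (∀ i, ReflTransGen D.Adj (s i) (p i)) ∧
        ∀ i : Fin m, (i : ℕ) < k → Drives D {v | ∃ j : Fin m, j < i ∧ p j = v} (s i) (p i) := by
      intro k
      induction k with
      | zero => exact ⟨p₀, hp₀, hr₀, by simp⟩
      | succ k ih =>
        obtain ⟨p, hp, hr, hd⟩ := ih
        by_cases hk : k < m
        swap
        · exact ⟨p, hp, hr, fun i _ => hd i (by omega)⟩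
        set c : Fin m := ⟨k, hk⟩ with hc
        obtain ⟨w, hw, hwc⟩ := exists_drives_of_reflTransGen
          (O := {v | ∃ j : Fin m, j < c ∧ p j = v}) (hr c)
          (by rintro ⟨j, hj, hjc⟩; exact hj.ne (hp hjc))
        -- Driver `c` takes `w`, and whoever was assigned `w` receives `p c`, which is reachable
        -- through `w`. Earlier drivers are unaffected, since `w` was free.
        have hlt : ∀ i : Fin m, i < c → Equiv.swap (p c) w (p i) = p i := fun i hi =>
          Equiv.swap_apply_of_ne_of_ne (fun h => hi.ne (hp h)) (fun h => hw.notMem ⟨i, hi, h⟩)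
        have hset : ∀ i : Fin m, i ≤ c →
            {v | ∃ j : Fin m, j < i ∧ Equiv.swap (p c) w (p j) = v} =
              {v | ∃ j : Fin m, j < i ∧ p j = v} := by
          intro i hi
          ext v
          refine exists_congr fun j => and_congr_right fun hj => ?_
          rw [hlt j (hj.trans_le hi)]
        refine ⟨fun i => Equiv.swap (p c) w (p i), (Equiv.injective _).comp hp, fun i => ?_,
          fun i hi => ?_⟩
        · by_cases h1 : p i = p c
          · have := hp h1
            subst this
            simpa using hw.reflTransGen
          by_cases h2 : p i = w
          · simp only [h2, Equiv.swap_apply_right]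
            exact (h2 ▸ hr i).trans hwc
          · beta_reduce
            rw [Equiv.swap_apply_of_ne_of_ne h1 h2]
            exact hr i
        · rcases Nat.lt_succ_iff_lt_or_eq.1 hi with h | h
          · have hic : i < c := h
            beta_reduce
            rw [hset i hic.le, hlt i hic]
            exact hd i h
          · obtain rfl : i = c := Fin.ext h
            beta_reduce
            rw [hset _ le_rfl, Equiv.swap_apply_left]
            exact hw
    obtain ⟨p, -, -, h⟩ := key m
    exact ⟨p, fun i => h i i.2⟩

end Reachability

/-! ### Excess of drivers over parking spaces. -/

section Excess

variable {V : Type*}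

open Classical in
/-- The number of drivers starting at a vertex, minus the one parking space there. -/
noncomputable def excess {m : ℕ} (s : Fin m → V) (v : V) : ℤ :=
  (Finset.univ.filter fun i => s i = v).card - 1

open Classical in
lemma sum_excess {m : ℕ} (s : Fin m → V) (U : Finset V) :
    ∑ v ∈ U, excess s v = (Finset.univ.filter fun i => s i ∈ U).card - U.card := by
  rw [Finset.card_eq_sum_card_fiberwise (f := s) (t := U) (by intro i; simp)]
  simp only [excess, Finset.sum_sub_distrib, Finset.sum_const, nsmul_eq_mul, mul_one, Nat.cast_sum,
    Finset.filter_filter]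
  congr 1
  refine Finset.sum_congr rfl fun v hv => ?_
  congr 2
  ext i
  simp only [Finset.mem_filter, Finset.mem_univ, true_and]
  exact ⟨fun h => ⟨h ▸ hv, h⟩, And.right⟩

end Excess

/-! ### Hall's condition in terms of descendants. -/

section Descendants

variable {V : Type*} [Fintype V]

open Classical in
/-- The vertices from which iterating `f` leads to `v`. -/
noncomputable def descendants (f : V → V) (v : V) : Finset V := {u | ∃ k, f^[k] u = v}

@[simp] lemma mem_descendants {f : V → V} {u v : V} : u ∈ descendants f v ↔ ∃ k, f^[k] u = v := by
  simp [descendants]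

lemma self_mem_descendants (f : V → V) (v : V) : v ∈ descendants f v :=
  mem_descendants.2 ⟨0, rfl⟩

/-- The total weight of the descendants of each vertex is nonpositive. -/
def DescNonpos (f : V → V) (w : V → ℤ) : Prop := ∀ v, ∑ u ∈ descendants f v, w u ≤ 0

lemma descendants_apply_perm (σ : Equiv.Perm V) (x : V) :
    descendants σ (σ x) = descendants σ x := by
  ext u
  simp only [mem_descendants]
  constructor
  · rintro ⟨k, hk⟩
    rcases k with _ | k
    · obtain ⟨j, hj, hfix⟩ := Function.mem_periodicPts.1 (σ.injective.mem_periodicPts x)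
      refine ⟨j - 1, ?_⟩
      obtain rfl : u = σ x := hk
      rw [← Function.iterate_succ_apply, Nat.succ_eq_add_one, Nat.sub_add_cancel hj]
      exact hfix
    · rw [Function.iterate_succ_apply'] at hk
      exact ⟨k, σ.injective hk⟩
  · rintro ⟨k, hk⟩
    exact ⟨k + 1, by rw [Function.iterate_succ_apply', hk]⟩

/-- A set closed under preimages splits into disjoint descendant sets: remove a largest one and
recurse. This reduces Hall's condition for arbitrary sets of drivers to one inequality per vertex.
-/
lemma DescNonpos.sum_nonpos {f : V → V} {w : V → ℤ} (h : DescNonpos f w) (U : Finset V)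
    (hU : ∀ u, f u ∈ U → u ∈ U) : ∑ u ∈ U, w u ≤ 0 := by
  classical
  induction U using Finset.strongInduction with
  | H U ih =>
    rcases U.eq_empty_or_nonempty with rfl | hne
    · simp
    have hclosed : ∀ k u, f^[k] u ∈ U → u ∈ U := by
      intro k
      induction k with
      | zero => simp
      | succ k ihk => exact fun u hu => hU u (ihk _ hu)
    obtain ⟨v, hv, hmax⟩ := U.exists_max_image (fun v => (descendants f v).card) hne
    have hsub : descendants f v ⊆ U := by
      intro u hu
      obtain ⟨k, hk⟩ := mem_descendants.1 hu
      exact hclosed k u (hk ▸ hv)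
    rw [← Finset.sum_sdiff hsub]
    refine add_nonpos (ih _ (Finset.sdiff_ssubset hsub ⟨v, self_mem_descendants f v⟩) ?_) (h v)
    intro u hu
    rw [Finset.mem_sdiff] at hu ⊢
    refine ⟨hU u hu.1, fun huv => hu.2 ?_⟩
    obtain ⟨k, hk⟩ := mem_descendants.1 huv
    cases k with
    | succ k => exact mem_descendants.2 ⟨k, hk⟩
    | zero =>
      obtain rfl : u = v := hk
      -- By maximality of the descendant set of `u`, this inclusion is an equality, which would make
      -- `f u` a descendant of `u`.
      have hss : descendants f u ⊆ descendants f (f u) := by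
        intro z hz
        obtain ⟨k, hk⟩ := mem_descendants.1 hz
        exact mem_descendants.2 ⟨k + 1, by rw [Function.iterate_succ_apply', hk]⟩
      rw [Finset.eq_of_subset_of_card_le hss (hmax _ hu.1)]
      exact self_mem_descendants f _

/-- Hall's condition for parking, where `f` sends each vertex to its unique in-neighbour. -/
lemma isParkingFunction_iff_descNonpos {D : Digraph V} {f : V → V} {m : ℕ}
    (hD : ∀ u v, ReflTransGen D.Adj u v ↔ ∃ k, f^[k] v = u) (s : Fin m → V) :
    IsParkingFunction D s ↔ DescNonpos f (excess s) := by
  classical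
  rw [isParkingFunction_iff_exists_injective]
  simp only [hD, ← mem_descendants]
  -- Hall's marriage theorem. For necessity, it is applied to all drivers starting among the
  -- descendants of `v`.
  rw [← Finset.all_card_le_biUnion_card_iff_exists_injective fun i => descendants f (s i)]
  constructor
  · intro h v
    rw [sum_excess, sub_nonpos, Nat.cast_le]
    refine (h _).trans (Finset.card_le_card ?_)
    intro u hu
    simp only [Finset.mem_biUnion, Finset.mem_filter, Finset.mem_univ, true_and,
      mem_descendants] at hu ⊢
    obtain ⟨i, ⟨k, hk⟩, l, hl⟩ := hu
    exact ⟨k + l, by rw [Function.iterate_add_apply, hl, hk]⟩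
  · intro h A
    have := h.sum_nonpos (A.biUnion fun i => descendants f (s i)) (by
      intro u hu
      simp only [Finset.mem_biUnion, mem_descendants] at hu ⊢
      obtain ⟨i, hi, k, hk⟩ := hu
      exact ⟨i, hi, k + 1, hk⟩)
    rw [sum_excess, sub_nonpos, Nat.cast_le] at this
    refine le_trans (Finset.card_le_card fun i hi => ?_) this
    simp only [Finset.mem_filter, Finset.mem_univ, true_and, Finset.mem_biUnion]
    exact ⟨i, hi, self_mem_descendants f _⟩

end Descendants

/-! ### Source trees and inverse mapping digraphs as parent maps. -/

section SourceTrees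

variable {V : Type*}

/-- The maps all of whose orbits end in the same fixed point, that is, the parent maps of
rooted trees. -/
def IsTreeMap (f : V → V) : Prop := ∃ r, f r = r ∧ ∀ u, ∃ k, f^[k] u = r

/-- The digraph with an edge to each vertex from its parent, without loops. -/
def childDigraph (f : V → V) : Digraph V where
  Adj u v := f v = u ∧ u ≠ v

/-- No information is lost with the loops: a vertex without incoming edge must be a fixed point. -/
lemma childDigraph_injective : Function.Injective (childDigraph : (V → V) → Digraph V) := by
  intro f g h
  have hadj : ∀ u v, (f v = u ∧ u ≠ v) ↔ (g v = u ∧ u ≠ v) := fun u v =>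
    iff_of_eq (congrFun (congrFun (congrArg Digraph.Adj h) u) v)
  funext v
  by_cases hf : f v = v
  · by_contra hne
    exact hne ((hadj (g v) v).2 ⟨rfl, fun e => hne (hf.trans e.symm)⟩).1
  · exact ((hadj (f v) v).1 ⟨rfl, hf⟩).1.symm

lemma reflTransGen_iff_exists_iterate {D : Digraph V} {f : V → V}
    (hD : ∀ u v, u ≠ v → (D.Adj u v ↔ f v = u)) (u v : V) :
    ReflTransGen D.Adj u v ↔ ∃ k, f^[k] v = u := by
  constructor
  · intro h
    induction h with
    | refl => exact ⟨0, rfl⟩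
    | @tail b c _ hbc ih =>
      obtain ⟨k, hk⟩ := ih
      by_cases hne : b = c
      · exact ⟨k, hne ▸ hk⟩
      · exact ⟨k + 1, by rw [Function.iterate_succ_apply, (hD b c hne).1 hbc, hk]⟩
  · rintro ⟨k, hk⟩
    induction k generalizing v with
    | zero => obtain rfl : v = u := hk; exact .refl
    | succ k ih =>
      have := ih (f v) hk
      by_cases hne : f v = v
      · rwa [hne] at this
      · exact this.tail ((hD _ _ hne).2 rfl)

lemma isParkingFunction_childDigraph_iff [Fintype V] (f : V → V) {m : ℕ} (s : Fin m → V) :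
    IsParkingFunction (childDigraph f) s ↔ DescNonpos f (excess s) :=
  isParkingFunction_iff_descNonpos
    (reflTransGen_iff_exists_iterate fun _ _ hne => and_iff_left hne) s

lemma isParkingFunction_reverse_mappingDigraph_iff [Fintype V] (f : V → V) {m : ℕ}
    (s : Fin m → V) :
    IsParkingFunction (reverse (mappingDigraph f)) s ↔ DescNonpos f (excess s) :=
  isParkingFunction_iff_descNonpos (reflTransGen_iff_exists_iterate fun _ _ _ => Iff.rfl) s

lemma exists_adj_dist_eq {G : SimpleGraph V} (hG : G.Connected) {r v : V} (hv : v ≠ r) :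
    ∃ u, G.Adj v u ∧ G.dist r v = G.dist r u + 1 := by
  obtain ⟨p, hp⟩ := hG.exists_walk_length_eq_dist v r
  cases p with
  | nil => exact absurd rfl hv
  | @cons _ u _ h q =>
    refine ⟨u, h, ?_⟩
    have h1 := G.dist_le q
    have h2 : G.dist v r ≤ G.dist v u + G.dist u r := hG.dist_triangle
    rw [SimpleGraph.dist_eq_one_iff_adj.2 h] at h2
    rw [SimpleGraph.Walk.length_cons] at hp
    rw [G.dist_comm (u := r), G.dist_comm (u := r)]
    omega

/-- In a tree, any neighbour of `v` closer to `r` is the penultimate vertex of the path from `r` to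
`v`; a shortest path to such a neighbour is too short to contain `v`. -/
lemma eq_of_adj_of_dist_eq {G : SimpleGraph V} (hG : G.IsTree) {r v u u' : V}
    (hu : G.Adj v u) (hu' : G.Adj v u') (hd : G.dist r v = G.dist r u + 1)
    (hd' : G.dist r v = G.dist r u' + 1) : u = u' := by
  classical
  obtain ⟨p, hp, -⟩ := hG.connected.exists_path_of_dist r v
  have key : ∀ x, G.Adj v x → G.dist r v = G.dist r x + 1 → x = p.penultimate := by
    intro x hx hdx
    obtain ⟨q, hq, hql⟩ := hG.connected.exists_path_of_dist r x
    refine hG.isAcyclic.eq_penultimate_of_adj_end hp hx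
      (hG.isAcyclic.mem_support_of_ne_mem_support_of_adj_of_isPath hp hq hx fun hv => ?_)
    have h1 := G.dist_le (q.takeUntil v hv)
    have h2 := q.length_takeUntil_le_length hv
    omega
  rw [key u hu hd, key u' hu' hd']

lemma exists_isTreeMap_of_isTree {G : SimpleGraph V} (hG : G.IsTree) (r : V) :
    ∃ f : V → V, IsTreeMap f ∧ childDigraph f = reverse (orientTowards G r) := by
  classical
  choose! f hf using fun v (hv : v ≠ r) => exists_adj_dist_eq hG.connected hv
  set g : V → V := fun v => if v = r then r else f v with hg
  have hgr : g r = r := if_pos rfl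
  have hgv : ∀ v, v ≠ r → g v = f v := fun v hv => if_neg hv
  refine ⟨g, ⟨r, hgr, fun u => ?_⟩, ?_⟩
  · induction h : G.dist r u generalizing u with
    | zero => exact ⟨0, (hG.connected.dist_eq_zero_iff.1 h).symm⟩
    | succ d ih =>
      have hu : u ≠ r := by rintro rfl; simp at h
      obtain ⟨k, hk⟩ := ih (f u) (by have := (hf u hu).2; omega)
      exact ⟨k + 1, by rw [Function.iterate_succ_apply, hgv u hu, hk]⟩
  · ext u v
    change (g v = u ∧ u ≠ v) ↔ (G.Adj v u ∧ G.dist r v = G.dist r u + 1)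
    by_cases hv : v = r
    · subst hv
      rw [hgr]
      constructor
      · rintro ⟨rfl, h⟩; exact absurd rfl h
      · rintro ⟨-, h⟩; simp at h
    · rw [hgv v hv]
      constructor
      · rintro ⟨rfl, -⟩; exact hf v hv
      · rintro ⟨h1, h2⟩
        exact ⟨eq_of_adj_of_dist_eq hG (hf v hv).1 h1 (hf v hv).2 h2, h1.ne'⟩

/-- The undirected graph joining each vertex to its parent. -/
def parentGraph (f : V → V) : SimpleGraph V := SimpleGraph.fromRel fun u v => f u = v

lemma parentGraph_adj {f : V → V} {u v : V} :
    (parentGraph f).Adj u v ↔ u ≠ v ∧ (f u = v ∨ f v = u) := SimpleGraph.fromRel_adj _ _ _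

lemma exists_walk_iterate (f : V → V) (k : ℕ) (u : V) :
    ∃ p : (parentGraph f).Walk u (f^[k] u), p.length ≤ k := by
  induction k generalizing u with
  | zero => exact ⟨.nil, le_rfl⟩
  | succ k ih =>
    obtain ⟨p, hp⟩ := ih (f u)
    rw [Function.iterate_succ_apply]
    by_cases h : u = f u
    · refine ⟨(p.copy h.symm rfl), ?_⟩
      rw [SimpleGraph.Walk.length_copy]; omega
    · refine ⟨.cons (parentGraph_adj.2 ⟨h, Or.inl rfl⟩) p, ?_⟩
      rw [SimpleGraph.Walk.length_cons]; omega

lemma IsTreeMap.connected_parentGraph {f : V → V} (hf : IsTreeMap f) :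
    (parentGraph f).Connected := by
  obtain ⟨r, -, hr⟩ := hf
  refine (SimpleGraph.connected_iff_exists_forall_reachable _).2 ⟨r, fun u => ?_⟩
  obtain ⟨k, hk⟩ := hr u
  exact ((exists_walk_iterate f k u).choose.copy rfl hk).reachable.symm

lemma eq_root_of_periodic {f : V → V} {r v : V} (hr : f r = r) {j k : ℕ}
    (hj : f^[j + 1] v = v) (hk : f^[k] v = r) : v = r := by
  have h1 : f^[(j + 1) * k] v = v := by
    rw [Function.iterate_mul, Function.iterate_fixed hj]
  have h2 : (j + 1) * k = j * k + k := by ring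
  rwa [h2, Function.iterate_add_apply, hk, Function.iterate_fixed hr, eq_comm] at h1

lemma IsTreeMap.isTree_parentGraph [Finite V] {f : V → V} (hf : IsTreeMap f) :
    (parentGraph f).IsTree := by
  classical
  have := Fintype.ofFinite V
  have hconn := hf.connected_parentGraph
  obtain ⟨r, hr, hk⟩ := hf
  refine SimpleGraph.isTree_iff_connected_and_card.2
    ⟨hconn, le_antisymm ?_ hconn.card_vert_le_card_edgeSet_add_one⟩
  -- Every edge joins some non-root to its parent, so there are at most `|V| - 1` edges.
  let e : {v // v ≠ r} → (parentGraph f).edgeSet := fun v =>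
    ⟨s(v.1, f v.1), parentGraph_adj.2 ⟨fun h => v.2 (by
      obtain ⟨k, hk⟩ := hk v.1
      exact eq_root_of_periodic hr (j := 0) h.symm hk), Or.inl rfl⟩⟩
  have he : Function.Surjective e := by
    rintro ⟨x, hx⟩
    induction x using Sym2.ind with
    | _ a b =>
      obtain ⟨hab, h | h⟩ := parentGraph_adj.1 hx
      · exact ⟨⟨a, fun e => hab (by rw [← h, e, hr])⟩, Subtype.ext (by simp [e, h])⟩
      · exact ⟨⟨b, fun e => hab (by rw [← h, e, hr])⟩, Subtype.ext (by simp [e, h, Sym2.eq_swap])⟩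
  have h1 := Nat.card_le_card_of_surjective e he
  have h2 : Nat.card {v // v ≠ r} + 1 = Nat.card V := by
    rw [Nat.card_eq_fintype_card, Nat.card_eq_fintype_card, Fintype.card_subtype_compl,
      Fintype.card_subtype_eq]
    have : 0 < Fintype.card V := Fintype.card_pos_iff.2 ⟨r⟩
    omega
  omega

lemma dist_parentGraph {f : V → V} {r : V} (hr : f r = r) (hk : ∀ u, ∃ k, f^[k] u = r) {v : V}
    (hv : v ≠ r) : (parentGraph f).dist r v = (parentGraph f).dist r (f v) + 1 := by
  classical
  set d : V → ℕ := fun u => Nat.find (hk u) with hd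
  have hdr : d r = 0 := (Nat.find_eq_zero _).2 rfl
  have hdv : ∀ u, u ≠ r → d u = d (f u) + 1 := fun u hu => by
    refine le_antisymm (Nat.find_min' _ (Nat.find_spec (hk (f u)))) ?_
    have hpos : d u ≠ 0 := fun h => hu ((Nat.find_eq_zero (hk u)).1 h)
    obtain ⟨k, hk'⟩ := Nat.exists_eq_succ_of_ne_zero hpos
    have hs : f^[d u] u = r := Nat.find_spec (hk u)
    rw [hk'] at hs ⊢
    exact Nat.succ_le_succ (Nat.find_min' _ hs)
  have hstep : ∀ u, d u ≤ d (f u) + 1 ∧ d (f u) ≤ d u + 1 := fun u => by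
    by_cases hu : u = r
    · rw [hu, hr]; omega
    · have := hdv u hu; omega
  -- The depth `d` changes by at most one along an edge, so it is a lower bound for the distance to
  -- `r`; iterating `f` gives the upper bound.
  have hlip : ∀ {u w : V} (p : (parentGraph f).Walk u w), d w ≤ d u + p.length := by
    intro u w p
    induction p with
    | nil => simp
    | @cons a b c h p ih =>
      rw [SimpleGraph.Walk.length_cons]
      obtain ⟨-, h | h⟩ := parentGraph_adj.1 h
      · have := (hstep a).2; rw [h] at this; omega
      · have := (hstep b).1; rw [h] at this; omega
  have hdist : ∀ u, (parentGraph f).dist r u = d u := fun u => by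
    have hconn : (parentGraph f).Connected := IsTreeMap.connected_parentGraph ⟨r, hr, hk⟩
    apply le_antisymm
    · obtain ⟨p, hp⟩ := exists_walk_iterate f (d u) u
      have hs : f^[d u] u = r := Nat.find_spec (hk u)
      rw [SimpleGraph.dist_comm]
      have := SimpleGraph.dist_le (p.copy rfl hs)
      rw [SimpleGraph.Walk.length_copy] at this
      omega
    · obtain ⟨p, hp⟩ := hconn.exists_walk_length_eq_dist r u
      have := hlip p
      omega
  rw [hdist, hdist, hdv v hv]

lemma IsTreeMap.exists_childDigraph_eq [Finite V] {f : V → V} (hf : IsTreeMap f) :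
    ∃ (G : SimpleGraph V) (r : V), G.IsTree ∧ childDigraph f = reverse (orientTowards G r) := by
  have htree := hf.isTree_parentGraph
  obtain ⟨r, hr, hk⟩ := hf
  refine ⟨parentGraph f, r, htree, ?_⟩
  ext u v
  change (f v = u ∧ u ≠ v) ↔ ((parentGraph f).Adj v u ∧
    (parentGraph f).dist r v = (parentGraph f).dist r u + 1)
  rw [parentGraph_adj]
  constructor
  · rintro ⟨rfl, h⟩
    exact ⟨⟨h.symm, Or.inl rfl⟩, dist_parentGraph hr hk fun e => h (by rw [e, hr])⟩
  · rintro ⟨⟨hne, h | h⟩, hd⟩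
    · exact ⟨h, hne.symm⟩
    · have := dist_parentGraph hr hk (v := u) fun e => hne (by rw [← h, e, hr])
      rw [h] at this
      omega

lemma sourceTrees_eq_image (n : ℕ) : sourceTrees n = childDigraph '' {f | IsTreeMap f} := by
  ext D
  constructor
  · rintro ⟨_, ⟨G, r, hG, rfl⟩, rfl⟩
    obtain ⟨f, hf, h⟩ := exists_isTreeMap_of_isTree hG r
    exact ⟨f, hf, h⟩
  · rintro ⟨f, hf, rfl⟩
    obtain ⟨G, r, hG, h⟩ := hf.exists_childDigraph_eq
    exact ⟨_, ⟨G, r, hG, rfl⟩, h.symm⟩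

open Classical in
lemma numParking_eq_card [Fintype V] {D : Digraph V} {f : V → V} {m : ℕ}
    (h : ∀ s : Fin m → V, IsParkingFunction D s ↔ DescNonpos f (excess s)) :
    numParking D m = (Finset.univ.filter fun s : Fin m → V => DescNonpos f (excess s)).card := by
  rw [numParking, ← Set.ncard_coe_finset]
  congr 1
  ext s
  simp [h]

open Classical in
lemma sum_card_filter_swap {α β : Type*} [Fintype α] [Fintype β] (p : α → Prop)
    (q : α → β → Prop) :
    ∑ a with p a, (Finset.univ.filter fun b => q a b).card =
      ∑ b, Nat.card {a // p a ∧ q a b} := by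
  simp only [Nat.card_eq_fintype_card, Fintype.card_subtype, Finset.card_filter, Finset.sum_filter]
  rw [Finset.sum_comm]
  refine Finset.sum_congr rfl fun a _ => ?_
  by_cases h : p a <;> simp [h]

lemma sourceTreeTotal_eq_sum (n m : ℕ) : sourceTreeTotal n m =
    ∑ s : Fin m → Fin n,
      Nat.card {f : Fin n → Fin n // IsTreeMap f ∧ DescNonpos f (excess s)} := by
  classical
  have himage : (Set.toFinite (sourceTrees n)).toFinset =
      (Finset.univ.filter fun f : Fin n → Fin n => IsTreeMap f).image childDigraph := by
    ext D
    rw [Set.Finite.mem_toFinset, sourceTrees_eq_image]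
    simp
  rw [sourceTreeTotal, himage, Finset.sum_image childDigraph_injective.injOn,
    ← sum_card_filter_swap]
  exact Finset.sum_congr (by congr) fun f _ =>
    numParking_eq_card (isParkingFunction_childDigraph_iff f)

lemma inverseMappingTotal_eq_sum (n m : ℕ) : inverseMappingTotal n m =
    ∑ s : Fin m → Fin n, Nat.card {f : Fin n → Fin n // DescNonpos f (excess s)} := by
  classical
  have hinj : Function.Injective fun f : Fin n → Fin n => reverse (mappingDigraph f) := by
    intro f g h
    funext v
    have := iff_of_eq (congrFun (congrFun (congrArg Digraph.Adj h) (f v)) v)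
    exact (this.1 rfl).symm
  have himage : (Set.toFinite (inverseMappingDigraphs n)).toFinset =
      (Finset.univ.filter fun _ : Fin n → Fin n => True).image
        fun f => reverse (mappingDigraph f) := by
    ext D
    rw [Set.Finite.mem_toFinset]
    simp [inverseMappingDigraphs, mappingDigraphs]
  have hswap := sum_card_filter_swap (fun _ : Fin n → Fin n => True)
    fun f (s : Fin m → Fin n) => DescNonpos f (excess s)
  simp only [true_and] at hswap
  rw [inverseMappingTotal, himage, Finset.sum_image hinj.injOn, ← hswap]
  exact Finset.sum_congr (by congr) fun f _ =>
    numParking_eq_card (isParkingFunction_reverse_mappingDigraph_iff f)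

end SourceTrees

/-! ### Partial sums along a list. -/

section PartialSums

variable {V : Type*}

/-- All partial sums of `c + a l₁ + a l₂ + ⋯` are nonpositive. -/
def PartialSumsNonpos (a : V → ℤ) : ℤ → List V → Prop
  | _, [] => True
  | c, z :: l => c + a z ≤ 0 ∧ PartialSumsNonpos a (c + a z) l

lemma partialSumsNonpos_congr {a b : V → ℤ} : ∀ {L : List V} {c : ℤ}, (∀ v ∈ L, a v = b v) →
    (PartialSumsNonpos a c L ↔ PartialSumsNonpos b c L)
  | [], _, _ => Iff.rfl
  | z :: l, c, h => by
    rw [PartialSumsNonpos, PartialSumsNonpos, h z (by simp),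
      partialSumsNonpos_congr fun v hv => h v (by simp [hv])]

end PartialSums

/-! ### Enumerations with nonpositive partial sums versus permutations with nonpositive cycle sums.
-/

section ListsAndPermutations

variable {V : Type*} [DecidableEq V]

/-- The element following `x` in `L`; the last element of `L` and the elements not in `L`
are fixed. -/
def listSucc : List V → V → V
  | [], x => x
  | [_], x => x
  | z :: y :: l, x => if x = z then y else listSucc (y :: l) x

/-- Insert `x` into a list right before `y`, or at the end if `y` does not occur. -/
def insertBefore (x y : V) : List V → List V
  | [] => [x]
  | z :: l => if z = y then x :: z :: l else z :: insertBefore x y l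

/-- Move the weight of `x` to `y`. -/
def moveWeight (a : V → ℤ) (x y : V) : V → ℤ :=
  fun v => a v - (if v = x then a x else 0) + (if v = y then a x else 0)

lemma listSucc_of_notMem {x : V} : ∀ {L : List V}, x ∉ L → listSucc L x = x
  | [], _ => rfl
  | [_], _ => rfl
  | z :: y :: l, h => by
    rw [listSucc, if_neg (fun e => h (by simp [e])), listSucc_of_notMem (fun e => h (by simp_all))]

lemma listSucc_mem {x : V} : ∀ {L : List V}, x ∈ L → listSucc L x ∈ L
  | [z], h => h
  | z :: y :: l, h => by
    rw [listSucc]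
    split_ifs with hz
    · simp
    · exact List.mem_cons_of_mem _ (listSucc_mem (by simpa [hz] using h))

lemma mem_insertBefore {x y v : V} : ∀ {L : List V}, v ∈ insertBefore x y L ↔ v = x ∨ v ∈ L
  | [] => by simp [insertBefore]
  | z :: l => by
    rw [insertBefore]
    split_ifs
    · simp
    · simp only [List.mem_cons, mem_insertBefore]; tauto

lemma nodup_insertBefore {x y : V} : ∀ {L : List V}, L.Nodup → x ∉ L → (insertBefore x y L).Nodup
  | [], _, _ => by simp [insertBefore]
  | z :: l, h, hx => by
    rw [insertBefore]
    split_ifs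
    · exact List.nodup_cons.2 ⟨hx, h⟩
    · rw [List.nodup_cons] at h ⊢
      simp only [List.mem_cons, not_or] at hx
      exact ⟨by rw [mem_insertBefore]; exact not_or.2 ⟨Ne.symm hx.1, h.1⟩,
        nodup_insertBefore h.2 hx.2⟩

lemma erase_insertBefore {x y : V} : ∀ {L : List V}, x ∉ L → (insertBefore x y L).erase x = L
  | [], _ => by simp [insertBefore]
  | z :: l, hx => by
    simp only [List.mem_cons, not_or] at hx
    rw [insertBefore]
    split_ifs
    · simp
    · rw [List.erase_cons_tail (by simpa using Ne.symm hx.1), erase_insertBefore hx.2]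

lemma listSucc_cons_of_ne {x z : V} (h : x ≠ z) (L : List V) :
    listSucc (z :: L) x = listSucc L x := by
  cases L with
  | nil => rfl
  | cons y l => rw [listSucc, if_neg h]

lemma listSucc_insertBefore {x y : V} : ∀ {L : List V}, x ∉ L → (y ∈ L ∨ y = x) →
    listSucc (insertBefore x y L) x = y
  | [], _, h => by
    simp only [List.not_mem_nil, false_or] at h
    simp [insertBefore, listSucc, h]
  | z :: l, hx, h => by
    simp only [List.mem_cons, not_or] at hx
    rw [insertBefore]
    split_ifs with hz
    · rw [listSucc, if_pos rfl, hz]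
    · rw [listSucc_cons_of_ne hx.1]
      refine listSucc_insertBefore hx.2 (h.imp_left fun h => ?_)
      exact (List.mem_cons.1 h).resolve_left (Ne.symm hz)

lemma insertBefore_listSucc_erase {x : V} : ∀ {L : List V}, L.Nodup → x ∈ L →
    insertBefore x (listSucc L x) (L.erase x) = L
  | [z], _, h => by
    obtain rfl := List.mem_singleton.1 h
    simp [insertBefore]
  | z :: y :: l, hL, h => by
    by_cases hz : x = z
    · subst hz
      simp [listSucc, insertBefore]
    · rw [List.nodup_cons] at hL
      have hx : x ∈ y :: l := (List.mem_cons.1 h).resolve_left hz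
      rw [listSucc_cons_of_ne hz, List.erase_cons_tail (by simpa using Ne.symm hz), insertBefore,
        if_neg, insertBefore_listSucc_erase hL.2 hx]
      exact fun e => hL.1 (e ▸ listSucc_mem hx)

lemma moveWeight_self (a : V → ℤ) (x : V) : moveWeight a x x = a := by
  ext v; simp [moveWeight]

lemma moveWeight_apply_of_ne {a : V → ℤ} {x y v : V} (hx : v ≠ x) (hy : v ≠ y) :
    moveWeight a x y v = a v := by
  simp [moveWeight, hx, hy]

/-- As `a x ≤ 0`, the partial sum ending at `x` is nonpositive whenever the one before it is; the
condition at `x` is thus redundant and `x` can be merged into `y`. -/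
lemma partialSumsNonpos_insertBefore {a : V → ℤ} {x y : V} (hax : a x ≤ 0) :
    ∀ {L : List V} {c : ℤ}, L.Nodup → x ∉ L → y ∈ L → c ≤ 0 →
      (PartialSumsNonpos a c (insertBefore x y L) ↔ PartialSumsNonpos (moveWeight a x y) c L)
  | z :: l, c, hL, hx, hy, hc => by
    rw [List.nodup_cons] at hL
    simp only [List.mem_cons, not_or] at hx
    rw [insertBefore]
    split_ifs with hz
    · subst hz
      have h1 : moveWeight a x z z = a z + a x := by simp [moveWeight, Ne.symm hx.1]
      rw [PartialSumsNonpos, PartialSumsNonpos, PartialSumsNonpos, h1,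
        partialSumsNonpos_congr (a := moveWeight a x z) (b := a), add_assoc, add_comm (a x) (a z)]
      · exact ⟨fun h => h.2, fun h => ⟨by omega, h⟩⟩
      · intro v hv
        exact moveWeight_apply_of_ne (fun e => hx.2 (e ▸ hv)) (fun e => hL.1 (e ▸ hv))
    · rw [PartialSumsNonpos, PartialSumsNonpos, moveWeight_apply_of_ne (Ne.symm hx.1) hz]
      refine and_congr_right fun h => partialSumsNonpos_insertBefore hax hL.2 hx.2 ?_ h
      exact (List.mem_cons.1 hy).resolve_left (Ne.symm hz)

/-- Here `x` goes to the end of the list. The total is zero, so the sum before `x` is `-a x ≥ 0`,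
and it is nonpositive only if `a x = 0`. -/
lemma partialSumsNonpos_insertBefore_self {a : V → ℤ} {x : V} (hax : a x ≤ 0) :
    ∀ {L : List V} {c : ℤ}, x ∉ L → c ≤ 0 → c + (L.map a).sum + a x = 0 →
      (PartialSumsNonpos a c (insertBefore x x L) ↔ a x = 0 ∧ PartialSumsNonpos a c L)
  | [], c, _, hc, hs => by
    simp only [insertBefore, PartialSumsNonpos, List.map_nil, List.sum_nil] at *
    constructor
    · intro _; exact ⟨by omega, trivial⟩
    · intro _; exact ⟨by omega, trivial⟩
  | z :: l, c, hx, hc, hs => by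
    simp only [List.mem_cons, not_or] at hx
    simp only [List.map_cons, List.sum_cons] at hs
    rw [insertBefore, if_neg (Ne.symm hx.1), PartialSumsNonpos, PartialSumsNonpos,
      and_left_comm]
    exact and_congr_right fun h => partialSumsNonpos_insertBefore_self hax hx.2 h (by omega)

/-- The enumerations of `K` with nonpositive partial sums. -/
abbrev GoodList (K : Finset V) (a : V → ℤ) : Type _ :=
  {L : List V // L.Nodup ∧ (∀ v, v ∈ L ↔ v ∈ K) ∧ PartialSumsNonpos a 0 L}

/-- The permutations of `K` with nonpositive cycle sums. -/
abbrev GoodPerm [Fintype V] (K : Finset V) (a : V → ℤ) : Type _ :=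
  {σ : Equiv.Perm V // (∀ v, v ∉ K → σ v = v) ∧ DescNonpos σ a}

/-- The possible successors of `x` in `K`, where `x` itself stands for having no successor. -/
abbrev Target (K : Finset V) (a : V → ℤ) (x : V) : Type _ :=
  {y : V // y ∈ K ∧ (y = x → a x = 0)}

lemma partialSumsNonpos_insertBefore_iff {K : Finset V} {a : V → ℤ} {x y : V}
    (hxK : x ∈ K) (hK : ∑ v ∈ K, a v = 0) (hax : a x ≤ 0) (hy : y ∈ K) {L : List V} (hL : L.Nodup)
    (hLK : ∀ v, v ∈ L ↔ v ∈ K.erase x) :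
    PartialSumsNonpos a 0 (insertBefore x y L) ↔
      (y = x → a x = 0) ∧ PartialSumsNonpos (moveWeight a x y) 0 L := by
  have hx : x ∉ L := by simp [hLK]
  by_cases hyx : y = x
  · subst hyx
    have hsum : (L.map a).sum + a y = 0 := by
      have hLK' : L.toFinset = K.erase y := by ext v; simp [hLK]
      rw [← List.sum_toFinset _ hL, hLK', Finset.sum_erase_add _ _ hxK, hK]
    rw [moveWeight_self, partialSumsNonpos_insertBefore_self hax hx le_rfl (by simpa using hsum)]
    simp
  · rw [partialSumsNonpos_insertBefore hax hL hx (by simp [hLK, hyx, hy]) le_rfl]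
    simp [hyx]

/-- Remove `x` from a list, adding its weight to its successor. -/
def goodListEquiv {K : Finset V} {a : V → ℤ} {x : V} (hxK : x ∈ K) (hK : ∑ v ∈ K, a v = 0)
    (hax : a x ≤ 0) :
    GoodList K a ≃ Σ y : Target K a x, GoodList (K.erase x) (moveWeight a x y) where
  toFun L :=
    have hx : x ∈ L.1 := (L.2.2.1 x).2 hxK
    have hy : listSucc L.1 x ∈ K := (L.2.2.1 _).1 (listSucc_mem hx)
    have hn : (L.1.erase x).Nodup := L.2.1.erase x
    have hm : ∀ v, v ∈ L.1.erase x ↔ v ∈ K.erase x := fun v => by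
      rw [L.2.1.mem_erase_iff, Finset.mem_erase, L.2.2.1]
    have hp := (partialSumsNonpos_insertBefore_iff hxK hK hax hy hn hm).1
      (by rw [insertBefore_listSucc_erase L.2.1 hx]; exact L.2.2.2)
    ⟨⟨listSucc L.1 x, hy, hp.1⟩, ⟨L.1.erase x, hn, hm, hp.2⟩⟩
  invFun p :=
    have hx : x ∉ p.2.1 := by simp [p.2.2.2.1]
    ⟨insertBefore x p.1.1 p.2.1, nodup_insertBefore p.2.2.1 hx, fun v => by
      rw [mem_insertBefore, p.2.2.2.1, Finset.mem_erase]
      by_cases hv : v = x <;> simp [hv, hxK],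
      (partialSumsNonpos_insertBefore_iff hxK hK hax p.1.2.1 p.2.2.1 p.2.2.2.1).2
        ⟨p.1.2.2, p.2.2.2.2⟩⟩
  left_inv L := Subtype.ext (insertBefore_listSucc_erase L.2.1 ((L.2.2.1 x).2 hxK))
  right_inv := by
    rintro ⟨⟨y, hy, hyx⟩, ⟨L, hn, hm, hp⟩⟩
    have hx : x ∉ L := by simp [hm]
    have h1 : listSucc (insertBefore x y L) x = y :=
      listSucc_insertBefore hx (by
        by_cases h : y = x
        · exact Or.inr h
        · exact Or.inl (by simp [hm, h, hy]))
    have h2 : (insertBefore x y L).erase x = L := erase_insertBefore hx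
    refine Sigma.ext (Subtype.ext h1) ?_
    refine (Subtype.heq_iff_coe_eq ?_).2 h2
    intro L'
    simp only [h1]

/-- The permutation `τ` fixes `x` and otherwise follows `σ`, jumping over `x`. One step of `τ` may
stand for two of `σ`, hence the strong induction in the second half. -/
lemma sameCycle_of_removed {σ τ : Equiv.Perm V} {x : V}
    (hτ : τ = Equiv.swap x (σ x) * σ) {v : V} (hv : v ≠ x) :
    ∀ {k : ℕ} {u : V}, u ≠ x → ((∃ k, τ^[k] u = v) → ∃ k, σ^[k] u = v) ∧
      (σ^[k] u = v → ∃ k, τ^[k] u = v) := by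
  have hstep : ∀ u, u ≠ x → σ u ≠ x → τ u = σ u := fun u hu h => by
    rw [hτ, Equiv.Perm.mul_apply]
    exact Equiv.swap_apply_of_ne_of_ne h (fun e => hu (σ.injective e))
  have hskip : ∀ u, σ u = x → τ u = σ x := fun u h => by
    rw [hτ, Equiv.Perm.mul_apply, h, Equiv.swap_apply_left]
  have hτx : τ x = x := by rw [hτ, Equiv.Perm.mul_apply, Equiv.swap_apply_right]
  intro k u hu
  constructor
  · rintro ⟨k, hk⟩
    induction k generalizing u with
    | zero => exact ⟨0, hk⟩
    | succ k ih =>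
      have hτu : τ u ≠ x := fun e => hu (τ.injective (e.trans hτx.symm))
      obtain ⟨j, hj⟩ := ih hτu hk
      by_cases h : σ u = x
      · rw [hskip u h] at hj
        exact ⟨j + 2, by simpa [h] using hj⟩
      · rw [hstep u hu h] at hj
        exact ⟨j + 1, hj⟩
  · induction k using Nat.strong_induction_on generalizing u with
    | _ k ih =>
      intro hk
      rcases k with _ | k
      · exact ⟨0, hk⟩
      by_cases h : σ u = x
      · rcases k with _ | k
        · exact absurd (hk.symm.trans h) hv
        · have hσx : σ x ≠ x := fun e => hu (σ.injective (h.trans e.symm))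
          obtain ⟨j, hj⟩ := ih k (by omega) hσx (by simpa [h] using hk)
          exact ⟨j + 1, by rw [Function.iterate_succ_apply, hskip u h, hj]⟩
      · obtain ⟨j, hj⟩ := ih k (by omega) h hk
        exact ⟨j + 1, by rw [Function.iterate_succ_apply, hstep u hu h, hj]⟩

lemma sum_moveWeight (a : V → ℤ) (x y : V) (S : Finset V) :
    ∑ v ∈ S, moveWeight a x y v =
      ∑ v ∈ S, a v - (if x ∈ S then a x else 0) + (if y ∈ S then a x else 0) := by
  simp [moveWeight, Finset.sum_add_distrib, Finset.sum_sub_distrib]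

variable [Fintype V]

lemma sum_descendants_removed {σ τ : Equiv.Perm V} {x : V}
    (hτ : τ = Equiv.swap x (σ x) * σ) (hσx : σ x ≠ x) (a : V → ℤ) {v : V} (hv : v ≠ x) :
    ∑ u ∈ descendants τ v, moveWeight a x (σ x) u = ∑ u ∈ descendants σ v, a u := by
  have hmem : ∀ u, u ≠ x → (u ∈ descendants τ v ↔ u ∈ descendants σ v) := fun u hu => by
    simp only [mem_descendants]
    exact ⟨(sameCycle_of_removed hτ hv (k := 0) hu).1,
      fun ⟨k, hk⟩ => (sameCycle_of_removed hτ hv (k := k) hu).2 hk⟩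
  have hxτ : x ∉ descendants τ v := by
    have hτx : τ x = x := by rw [hτ, Equiv.Perm.mul_apply, Equiv.swap_apply_right]
    rw [mem_descendants]
    rintro ⟨k, hk⟩
    rw [Function.iterate_fixed hτx] at hk
    exact hv hk.symm
  have hxσ : x ∈ descendants σ v ↔ σ x ∈ descendants σ v := by
    simp only [mem_descendants]
    constructor
    · rintro ⟨k, hk⟩
      rcases k with _ | k
      · exact absurd hk.symm hv
      · exact ⟨k, hk⟩
    · rintro ⟨k, hk⟩
      exact ⟨k + 1, hk⟩
  have herase : descendants τ v = (descendants σ v).erase x := by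
    ext u
    rw [Finset.mem_erase]
    by_cases hu : u = x
    · subst hu; simp [hxτ]
    · simp [hu, hmem u hu]
  have hiff : σ x ∈ descendants τ v ↔ x ∈ descendants σ v := (hmem _ hσx).trans hxσ.symm
  rw [sum_moveWeight, if_neg hxτ, if_congr hiff rfl rfl, herase]
  split_ifs with h
  · rw [sub_zero, Finset.sum_erase_add _ _ h]
  · rw [Finset.erase_eq_of_notMem h]; ring

/-- The counterpart for cycles of `partialSumsNonpos_insertBefore_iff`: merging `x` into `σ x` keeps
all cycle sums. -/
lemma descNonpos_removed_iff {σ : Equiv.Perm V} {a : V → ℤ} {x : V} (hsum : ∑ v, a v = 0)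
    (hax : a x ≤ 0) :
    DescNonpos σ a ↔ (σ x = x → a x = 0) ∧
      DescNonpos (Equiv.swap x (σ x) * σ : Equiv.Perm V) (moveWeight a x (σ x)) := by
  by_cases hσx : σ x = x
  · simp only [hσx, Equiv.swap_self, moveWeight_self, true_imp_iff]
    have : (Equiv.refl V : Equiv.Perm V) * σ = σ := one_mul σ
    rw [this]
    refine ⟨fun h => ⟨le_antisymm hax ?_, h⟩, And.right⟩
    -- The complement of the fixed point `x` has nonpositive sum and the total is zero, so `a x ≥
    -- 0`.
    have h1 := h.sum_nonpos (Finset.univ.erase x) (by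
      intro u hu
      rw [Finset.mem_erase] at hu ⊢
      refine ⟨?_, Finset.mem_univ _⟩
      rintro rfl
      exact hu.1 hσx)
    have h2 := Finset.sum_erase_add Finset.univ a (Finset.mem_univ x)
    omega
  · simp only [hσx, false_imp_iff, true_and]
    set τ : Equiv.Perm V := Equiv.swap x (σ x) * σ with hτ
    have key := fun v hv => sum_descendants_removed (v := v) hτ hσx a hv
    constructor
    · intro h v
      by_cases hv : v = x
      · subst hv
        have hτx : τ v = v := by rw [hτ, Equiv.Perm.mul_apply, Equiv.swap_apply_right]
        have : descendants τ v = {v} := by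
          ext u
          rw [mem_descendants, Finset.mem_singleton]
          constructor
          · rintro ⟨k, hk⟩
            have := Function.iterate_fixed hτx k
            exact (τ.injective.iterate k) (hk.trans this.symm)
          · rintro rfl
            exact ⟨0, rfl⟩
        simp [this, moveWeight, Ne.symm hσx]
      · rw [key v hv]
        exact h v
    · intro h v
      by_cases hv : v = x
      · rw [hv, ← descendants_apply_perm, ← key _ hσx]
        exact h _
      · rw [← key v hv]
        exact h v

/-- Remove `x` from a permutation, adding its weight to its image. -/
def goodPermEquiv {K : Finset V} {a : V → ℤ} {x : V} (hxK : x ∈ K) (hsum : ∑ v, a v = 0)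
    (hax : a x ≤ 0) :
    GoodPerm K a ≃ Σ y : Target K a x, GoodPerm (K.erase x) (moveWeight a x y) where
  toFun σ :=
    have hp := (descNonpos_removed_iff hsum hax).1 σ.2.2
    ⟨⟨σ.1 x, by
        by_contra h
        have := σ.1.injective (σ.2.1 _ h)
        exact h (this.symm ▸ hxK), hp.1⟩,
      ⟨Equiv.swap x (σ.1 x) * σ.1, fun v hv => by
        rw [Equiv.Perm.mul_apply]
        by_cases hvx : v = x
        · rw [hvx, Equiv.swap_apply_right]
        · have hvK : v ∉ K := fun h => hv (Finset.mem_erase.2 ⟨hvx, h⟩)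
          have hσv := σ.2.1 v hvK
          rw [hσv]
          refine Equiv.swap_apply_of_ne_of_ne hvx fun e => hvx (σ.1.injective ?_)
          rw [hσv, ← e], hp.2⟩⟩
  invFun p :=
    have hx : p.2.1 x = x := p.2.2.1 x (by simp)
    ⟨Equiv.swap x p.1.1 * p.2.1, fun v hv => by
      have hvx : v ≠ x := fun e => hv (e ▸ hxK)
      rw [Equiv.Perm.mul_apply, p.2.2.1 v (fun h => hv (Finset.mem_of_mem_erase h))]
      exact Equiv.swap_apply_of_ne_of_ne hvx fun e => hv (e ▸ p.1.2.1), by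
      rw [descNonpos_removed_iff hsum hax]
      have hy : (Equiv.swap x p.1.1 * p.2.1) x = p.1.1 := by
        rw [Equiv.Perm.mul_apply, hx, Equiv.swap_apply_left]
      rw [hy, Equiv.swap_mul_self_mul]
      exact ⟨p.1.2.2, p.2.2.2⟩⟩
  left_inv σ := Subtype.ext (Equiv.swap_mul_self_mul _ _ _)
  right_inv := by
    rintro ⟨⟨y, hy, hyx⟩, ⟨σ, hσ, hp⟩⟩
    have h1 : (Equiv.swap x y * σ) x = y := by
      rw [Equiv.Perm.mul_apply, hσ x (by simp), Equiv.swap_apply_left]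
    have h2 : Equiv.swap x ((Equiv.swap x y * σ) x) * (Equiv.swap x y * σ) = σ := by
      rw [h1, Equiv.swap_mul_self_mul]
    refine Sigma.ext (Subtype.ext h1) ?_
    refine (Subtype.heq_iff_coe_eq ?_).2 h2
    intro τ
    simp only [h1]

/-- For weights of total zero there are as many enumerations with nonpositive partial sums as
permutations with nonpositive cycle sums. -/
theorem nonempty_goodList_equiv_goodPerm (K : Finset V) (a : V → ℤ) (ha : ∀ v, v ∉ K → a v = 0)
    (hsum : ∑ v, a v = 0) : Nonempty (GoodList K a ≃ GoodPerm K a) := by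
  induction K using Finset.strongInduction generalizing a with
  | H K ih =>
    have hK : ∑ v ∈ K, a v = 0 := by
      rw [← hsum]
      exact Finset.sum_subset (Finset.subset_univ K) fun v _ hv => ha v hv
    rcases K.eq_empty_or_nonempty with rfl | hne
    · have h0 : a = 0 := funext fun v => ha v (by simp)
      have : Unique (GoodList ∅ a) :=
        { default := ⟨[], by simp [PartialSumsNonpos]⟩
          uniq := fun L => Subtype.ext (List.eq_nil_iff_forall_not_mem.2 fun v hv => by
            simpa using (L.2.2.1 v).1 hv) }
      have : Unique (GoodPerm ∅ a) :=
        { default := ⟨1, by simp [DescNonpos, h0]⟩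
          uniq := fun σ => Subtype.ext (Equiv.ext fun v => σ.2.1 v (by simp)) }
      exact ⟨Equiv.ofUnique _ _⟩
    · obtain ⟨x, hxK, hax⟩ : ∃ x ∈ K, a x ≤ 0 := by
        by_contra! h
        exact (Finset.sum_pos h hne).ne' hK
      have hrec : ∀ y : Target K a x, Nonempty
          (GoodList (K.erase x) (moveWeight a x y) ≃ GoodPerm (K.erase x) (moveWeight a x y)) := by
        rintro ⟨y, hy, hyx⟩
        refine ih _ (Finset.erase_ssubset hxK) _ (fun v hv => ?_) ?_
        · by_cases hvx : v = x
          · subst hvx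
            -- If `x` has no successor its weight is not moved, but then membership in `Target` says
            -- that it is zero.
            by_cases hvy : v = y
            · change moveWeight a v y v = 0
              rw [← hvy, moveWeight_self]
              exact hyx hvy.symm
            · simp [moveWeight, hvy]
          · have hvK : v ∉ K := fun h => hv (Finset.mem_erase.2 ⟨hvx, h⟩)
            rw [moveWeight_apply_of_ne hvx (fun e => hvK (e ▸ hy)), ha v hvK]
        · rw [sum_moveWeight, hsum]; simp
      exact ⟨(goodListEquiv hxK hK hax).trans
        ((Equiv.sigmaCongrRight fun y => (hrec y).some).trans (goodPermEquiv hxK hsum hax).symm)⟩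

end ListsAndPermutations

/-! ### Paths following a map to a fixed point. -/

section Rays

variable {V : Type*}

/-- `L` follows `f` and ends in a fixed point of `f`. -/
def IsRay (f : V → V) : List V → Prop
  | [] => True
  | [z] => f z = z
  | z :: y :: l => f z = y ∧ IsRay f (y :: l)

/-- A ray is forced step by step by `f`; without repetitions it must also stop as soon as it meets a
fixed point. -/
lemma IsRay.eq_of_head_eq {f : V → V} : ∀ {L L' : List V}, IsRay f L → IsRay f L' →
    L.Nodup → L'.Nodup → L.head? = L'.head? → L = L'
  | [], [], _, _, _, _, _ => rfl
  | [], _ :: _, _, _, _, _, h => by simp at h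
  | _ :: _, [], _, _, _, _, h => by simp at h
  | [z], [z'], _, _, _, _, h => by simpa using h
  | [z], z' :: y' :: l', h1, h2, _, h4, h => by
    obtain rfl : z = z' := by simpa using h
    exact absurd (h1.symm.trans h2.1) (by rintro rfl; simp at h4)
  | z :: y :: l, [z'], h1, h2, h3, _, h => by
    obtain rfl : z = z' := by simpa using h
    exact absurd (h2.symm.trans h1.1) (by rintro rfl; simp at h3)
  | z :: y :: l, z' :: y' :: l', h1, h2, h3, h4, h => by
    obtain rfl : z = z' := by simpa using h
    rw [List.nodup_cons] at h3 h4
    obtain rfl : y = y' := h1.1.symm.trans h2.1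
    rw [IsRay.eq_of_head_eq h1.2 h2.2 h3.2 h4.2 rfl]

lemma exists_isRay {f : V → V} {r : V} (hr : f r = r) (k : ℕ) (v : V) (hk : f^[k] v = r) :
    ∃ L : List V, IsRay f L ∧ L.Nodup ∧ L.head? = some v ∧ r ∈ L ∧ ∀ x ∈ L, ∃ j, f^[j] v = x := by
  induction k generalizing v with
  | zero =>
    obtain rfl : v = r := hk
    exact ⟨[v], hr, by simp, rfl, by simp, by simpa using ⟨0, rfl⟩⟩
  | succ k ih =>
    by_cases hv : v = r
    · subst hv
      exact ⟨[v], hr, by simp, rfl, by simp, by simpa using ⟨0, rfl⟩⟩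
    obtain ⟨L, hL, hn, hh, hrL, hj⟩ := ih (f v) hk
    cases L with
    | nil => simp at hrL
    | cons y l =>
      obtain rfl : y = f v := by simpa using hh
      refine ⟨v :: f v :: l, ⟨rfl, hL⟩, List.nodup_cons.2 ⟨fun hvL => ?_, hn⟩, rfl,
        List.mem_cons_of_mem _ hrL, fun x hx => ?_⟩
      · obtain ⟨j, hj⟩ := hj v hvL
        exact hv (eq_root_of_periodic hr hj hk)
      · rcases List.mem_cons.1 hx with rfl | hx
        · exact ⟨0, rfl⟩
        · obtain ⟨j, hj⟩ := hj x hx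
          exact ⟨j + 1, hj⟩

lemma descendants_eq_singleton [Fintype V] {f : V → V} {z : V} (h : ∀ u, u ≠ z → f u ≠ z) :
    descendants f z = {z} := by
  ext u
  rw [mem_descendants, Finset.mem_singleton]
  constructor
  · rintro ⟨k, hk⟩
    induction k generalizing u with
    | zero => exact hk
    | succ k ih =>
      by_contra hu
      exact h u hu (ih (f u) hk)
  · rintro rfl
    exact ⟨0, rfl⟩

end Rays

/-! ### The successor map of a list and its descendants. -/

section ListSuccessor

variable {V : Type*} [DecidableEq V]

lemma isRay_iff_eqOn {f : V → V} : ∀ {L : List V}, L.Nodup →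
    (IsRay f L ↔ ∀ x ∈ L, f x = listSucc L x)
  | [], _ => by simp [IsRay]
  | [z], _ => by simp [IsRay, listSucc]
  | z :: y :: l, h => by
    rw [List.nodup_cons] at h
    rw [IsRay, isRay_iff_eqOn h.2, List.forall_mem_cons (a := z), listSucc, if_pos rfl]
    refine and_congr_right fun _ => forall₂_congr fun x hx => ?_
    have hxz : x ≠ z := by rintro rfl; exact h.1 hx
    rw [listSucc_cons_of_ne hxz]

lemma iterate_listSucc_cons {z u : V} {L : List V} (hz : z ∉ L) (hu : u ≠ z) (k : ℕ) :
    (listSucc (z :: L))^[k] u = (listSucc L)^[k] u ∧ (listSucc L)^[k] u ≠ z := by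
  induction k generalizing u with
  | zero => exact ⟨rfl, hu⟩
  | succ k ih =>
    rw [Function.iterate_succ_apply, Function.iterate_succ_apply, listSucc_cons_of_ne hu]
    refine ih ?_
    by_cases huL : u ∈ L
    · exact fun e => hz (e ▸ listSucc_mem huL)
    · rwa [listSucc_of_notMem huL]

lemma exists_iterate_listSucc_head : ∀ {y : V} {l : List V}, (y :: l).Nodup → ∀ x ∈ y :: l,
    ∃ k, (listSucc (y :: l))^[k] y = x
  | y, [], _, x, hx => ⟨0, by simpa using (List.mem_singleton.1 hx).symm⟩
  | y, y' :: l, h, x, hx => by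
    rw [List.nodup_cons] at h
    rcases List.mem_cons.1 hx with rfl | hx
    · exact ⟨0, rfl⟩
    · obtain ⟨k, hk⟩ := exists_iterate_listSucc_head h.2 x hx
      refine ⟨k + 1, ?_⟩
      have hne : y' ≠ y := by rintro rfl; simp at h
      rw [Function.iterate_succ_apply, listSucc, if_pos rfl, (iterate_listSucc_cons h.1 hne k).1,
        hk]

lemma exists_listSucc_eq_self : ∀ {L : List V}, L.Nodup → L ≠ [] →
    ∃ r ∈ L, listSucc L r = r ∧ ∀ x ∈ L, ∃ k, (listSucc L)^[k] x = r
  | [z], _, _ => ⟨z, by simp, rfl, by simpa using ⟨0, rfl⟩⟩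
  | z :: y :: l, h, _ => by
    have hn := h
    rw [List.nodup_cons] at h
    obtain ⟨r, hr, hrr, hk⟩ := exists_listSucc_eq_self h.2 (by simp)
    have hne : ∀ {x}, x ∈ y :: l → x ≠ z := fun hx e => h.1 (e ▸ hx)
    refine ⟨r, List.mem_cons_of_mem _ hr, by rw [listSucc_cons_of_ne (hne hr), hrr],
      fun x hx => ?_⟩
    rcases List.mem_cons.1 hx with rfl | hx
    · exact exists_iterate_listSucc_head hn r (List.mem_cons_of_mem _ hr)
    · obtain ⟨k, hk⟩ := hk x hx
      exact ⟨k, by rw [(iterate_listSucc_cons h.1 (hne hx) k).1, hk]⟩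

/-- The descendants of `x` under `listSucc L` are the initial segment of `L` ending at `x`, so their
sums are the partial sums. -/
lemma partialSumsNonpos_iff_descendants [Fintype V] {a : V → ℤ} : ∀ {L : List V} {c : ℤ},
    L.Nodup → (PartialSumsNonpos a c L ↔
      ∀ x ∈ L, c + ∑ u ∈ descendants (listSucc L) x, a u ≤ 0)
  | [], _, _ => by simp [PartialSumsNonpos]
  | z :: l, c, h => by
    rw [List.nodup_cons] at h
    have hz : descendants (listSucc (z :: l)) z = {z} := by
      refine descendants_eq_singleton fun u hu => ?_
      have := iterate_listSucc_cons h.1 hu 1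
      simp only [Function.iterate_one] at this
      rw [this.1]
      exact this.2
    rw [PartialSumsNonpos, partialSumsNonpos_iff_descendants h.2, List.forall_mem_cons, hz,
      Finset.sum_singleton]
    refine and_congr_right fun _ => forall₂_congr fun x hx => ?_
    have hxz : x ≠ z := fun e => h.1 (e ▸ hx)
    have hnot : z ∉ descendants (listSucc l) x := by
      rw [mem_descendants]
      rintro ⟨k, hk⟩
      rw [Function.iterate_fixed (listSucc_of_notMem h.1)] at hk
      exact hxz hk.symm
    have hins : descendants (listSucc (z :: l)) x = insert z (descendants (listSucc l) x) := by
      ext u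
      rw [Finset.mem_insert, mem_descendants, mem_descendants]
      by_cases hu : u = z
      · subst hu
        refine iff_of_true ?_ (Or.inl rfl)
        exact exists_iterate_listSucc_head (List.nodup_cons.2 h) x (List.mem_cons_of_mem _ hx)
      · simp only [hu, false_or]
        exact exists_congr fun k => by rw [(iterate_listSucc_cons h.1 hu k).1]
    rw [hins, Finset.sum_insert hnot, add_assoc]

lemma partialSumsNonpos_iff_descNonpos [Fintype V] {a : V → ℤ} {L : List V} (hL : L.Nodup)
    (ha : ∀ v, v ∉ L → a v = 0) : PartialSumsNonpos a 0 L ↔ DescNonpos (listSucc L) a := by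
  rw [partialSumsNonpos_iff_descendants hL]
  simp only [zero_add]
  refine ⟨fun h v => ?_, fun h v _ => h v⟩
  by_cases hv : v ∈ L
  · exact h v hv
  · rw [descendants_eq_singleton, Finset.sum_singleton, ha v hv]
    intro u hu
    by_cases huL : u ∈ L
    · exact fun e => hv (e ▸ listSucc_mem huL)
    · rwa [listSucc_of_notMem huL]

end ListSuccessor

/-! ### Cutting trees and maps into a forest and a structure on its roots. -/

section Forests

variable {V : Type*}

/-- The maps all of whose orbits end in fixed points, that is, the parent maps of
rooted forests. -/
def IsForestMap (g : V → V) : Prop := ∀ u, ∃ k, g (g^[k] u) = g^[k] u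

/-- The root of the tree of `u` in a forest. -/
noncomputable def IsForestMap.root {g : V → V} (hg : IsForestMap g) (u : V) : V :=
  g^[(hg u).choose] u

open Classical in
/-- The map acting as `h` on the roots of the forest `g` and as `g` on the other vertices. -/
noncomputable def graft (h g : V → V) (v : V) : V := if g v = v then h v else g v

open Classical in
/-- The map fixing the points of `S` and acting as `f` outside. -/
noncomputable def collapse (f : V → V) (S : Set V) (v : V) : V :=
  if v ∈ S then v else f v

variable {f g h : V → V}

lemma graft_of_eq {v : V} (hv : g v = v) : graft h g v = h v := if_pos hv

lemma graft_of_ne {v : V} (hv : g v ≠ v) : graft h g v = g v := if_neg hv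

lemma IsForestMap.apply_root (hg : IsForestMap g) (u : V) : g (hg.root u) = hg.root u :=
  (hg u).choose_spec

lemma iterate_eq_of_fixed {u x y : V} {j k : ℕ} (hx : g x = x) (hy : g y = y)
    (hj : g^[j] u = x) (hk : g^[k] u = y) : x = y := by
  have h1 : g^[k + j] u = x := by rw [Function.iterate_add_apply, hj, Function.iterate_fixed hx]
  have h2 : g^[j + k] u = y := by rw [Function.iterate_add_apply, hk, Function.iterate_fixed hy]
  rw [← h1, ← h2, add_comm]

lemma IsForestMap.root_eq_iff (hg : IsForestMap g) {u x : V} :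
    hg.root u = x ↔ g x = x ∧ ∃ k, g^[k] u = x := by
  constructor
  · rintro rfl
    exact ⟨hg.apply_root u, _, rfl⟩
  · rintro ⟨hx, k, hk⟩
    exact iterate_eq_of_fixed (hg.apply_root u) hx rfl hk

lemma IsForestMap.root_of_eq (hg : IsForestMap g) {u : V} (hu : g u = u) : hg.root u = u :=
  hg.root_eq_iff.2 ⟨hu, 0, rfl⟩

lemma IsForestMap.root_apply (hg : IsForestMap g) (u : V) : hg.root (g u) = hg.root u := by
  obtain ⟨h1, k, hk⟩ := hg.root_eq_iff.1 (rfl : hg.root (g u) = _)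
  exact (hg.root_eq_iff.2 ⟨h1, k + 1, hk⟩).symm

lemma exists_iterate_graft_eq_root (h : V → V) (hg : IsForestMap g) (u : V) :
    ∃ k, (graft h g)^[k] u = hg.root u := by
  obtain ⟨-, k, hk⟩ := hg.root_eq_iff.1 (rfl : hg.root u = _)
  induction k generalizing u with
  | zero => exact ⟨0, hk⟩
  | succ k ih =>
    by_cases hu : g u = u
    · exact ⟨0, (hg.root_of_eq hu).symm⟩
    · obtain ⟨j, hj⟩ := ih (g u) (by rw [hg.root_apply]; exact hk)
      exact ⟨j + 1, by rw [Function.iterate_succ_apply, graft_of_ne hu, hj, hg.root_apply]⟩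

lemma iterate_graft_of_eq (hh : ∀ v, g v = v → g (h v) = h v) {v : V} (hv : g v = v) (k : ℕ) :
    (graft h g)^[k] v = h^[k] v ∧ g (h^[k] v) = h^[k] v := by
  induction k generalizing v with
  | zero => exact ⟨rfl, hv⟩
  | succ k ih =>
    rw [Function.iterate_succ_apply, Function.iterate_succ_apply, graft_of_eq hv]
    exact ih (hh v hv)

lemma collapse_of_mem {S : Set V} {v : V} (hv : v ∈ S) : collapse f S v = v := if_pos hv

lemma collapse_of_notMem {S : Set V} {v : V} (hv : v ∉ S) : collapse f S v = f v := if_neg hv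

lemma collapse_eq_self_iff {S : Set V} (hS : ∀ v, f v = v → v ∈ S) {v : V} :
    collapse f S v = v ↔ v ∈ S := by
  refine ⟨fun hv => ?_, collapse_of_mem⟩
  by_contra h
  exact h (hS v (by rwa [collapse_of_notMem h] at hv))

lemma isForestMap_collapse {S : Set V} (hS : ∀ u, ∃ k, f^[k] u ∈ S) :
    IsForestMap (collapse f S) := by
  intro u
  obtain ⟨k, hk⟩ := hS u
  induction k generalizing u with
  | zero => exact ⟨0, collapse_of_mem hk⟩
  | succ k ih =>
    by_cases hu : u ∈ S
    · exact ⟨0, collapse_of_mem hu⟩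
    · obtain ⟨j, hj⟩ := ih (f u) hk
      exact ⟨j + 1, by rwa [Function.iterate_succ_apply, collapse_of_notMem hu]⟩

lemma graft_collapse {S : Set V} (hS : ∀ v, f v = v → v ∈ S) (hh : ∀ v ∈ S, h v = f v) :
    graft h (collapse f S) = f := by
  funext v
  by_cases hv : v ∈ S
  · rw [graft_of_eq (collapse_of_mem hv), hh v hv]
  · rw [graft_of_ne (mt (collapse_eq_self_iff hS).1 hv), collapse_of_notMem hv]

lemma eq_of_graft_eq {g' h' : V → V} (hfix : ∀ v, g v = v ↔ g' v = v)
    (hgraft : graft h g = graft h' g') : g = g' := by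
  funext v
  by_cases hv : g v = v
  · rw [hv, (hfix v).1 hv]
  · rw [← graft_of_ne (h := h) hv, hgraft, graft_of_ne (mt (hfix v).2 hv)]

variable [Fintype V]

open Classical in
/-- The total weight of the tree with a given root. -/
noncomputable def IsForestMap.rootWeight (hg : IsForestMap g) (w : V → ℤ) (x : V) : ℤ :=
  ∑ u with hg.root u = x, w u

lemma IsForestMap.rootWeight_of_ne (hg : IsForestMap g) (w : V → ℤ) {x : V} (hx : g x ≠ x) :
    hg.rootWeight w x = 0 := by
  classical
  rw [rootWeight]
  refine Finset.sum_eq_zero fun u hu => absurd (hg.apply_root u) ?_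
  rwa [(Finset.mem_filter.1 hu).2]

open Classical in
lemma IsForestMap.sum_rootWeight (hg : IsForestMap g) (w : V → ℤ) (S : Finset V) :
    ∑ x ∈ S, hg.rootWeight w x = ∑ u with hg.root u ∈ S, w u := by
  rw [← Finset.sum_fiberwise_of_maps_to (s := Finset.univ.filter fun u => hg.root u ∈ S)
    (fun u hu => (Finset.mem_filter.1 hu).2)]
  refine Finset.sum_congr rfl fun x hx => ?_
  rw [rootWeight, Finset.filter_filter]
  refine Finset.sum_congr (Finset.filter_congr fun u _ => ?_) fun _ _ => rfl
  exact ⟨fun h => ⟨h ▸ hx, h⟩, And.right⟩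

lemma IsForestMap.sum_univ_rootWeight (hg : IsForestMap g) (w : V → ℤ) :
    ∑ x, hg.rootWeight w x = ∑ u, w u := by
  rw [hg.sum_rootWeight]; simp

lemma descendants_graft_of_ne (hh : ∀ v, g v = v → g (h v) = h v) {v : V} (hv : g v ≠ v) :
    descendants (graft h g) v = descendants g v := by
  ext u
  rw [mem_descendants, mem_descendants]
  constructor
  · rintro ⟨k, hk⟩
    induction k generalizing u with
    | zero => exact ⟨0, hk⟩
    | succ k ih =>
      by_cases hu : g u = u
      · have := iterate_graft_of_eq hh hu (k + 1)
        rw [← this.1, hk] at this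
        exact absurd this.2 hv
      · rw [Function.iterate_succ_apply, graft_of_ne hu] at hk
        obtain ⟨j, hj⟩ := ih _ hk
        exact ⟨j + 1, hj⟩
  · rintro ⟨k, hk⟩
    induction k generalizing u with
    | zero => exact ⟨0, hk⟩
    | succ k ih =>
      by_cases hu : g u = u
      · rw [Function.iterate_fixed hu] at hk
        exact absurd (hk ▸ hu) hv
      · obtain ⟨j, hj⟩ := ih _ hk
        exact ⟨j + 1, by rw [Function.iterate_succ_apply, graft_of_ne hu, hj]⟩

lemma mem_descendants_graft_of_eq (hg : IsForestMap g) (hh : ∀ v, g v = v → g (h v) = h v)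
    {u v : V} (hv : g v = v) :
    u ∈ descendants (graft h g) v ↔ hg.root u ∈ descendants h v := by
  rw [mem_descendants, mem_descendants]
  constructor
  · rintro ⟨k, hk⟩
    induction k generalizing u with
    | zero =>
      obtain rfl : u = v := hk
      exact ⟨0, hg.root_of_eq hv⟩
    | succ k ih =>
      by_cases hu : g u = u
      · exact ⟨k + 1, by rw [hg.root_of_eq hu, ← (iterate_graft_of_eq hh hu _).1, hk]⟩
      · rw [Function.iterate_succ_apply, graft_of_ne hu] at hk
        obtain ⟨j, hj⟩ := ih hk
        exact ⟨j, by rwa [hg.root_apply] at hj⟩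
  · rintro ⟨k, hk⟩
    obtain ⟨j, hj⟩ := exists_iterate_graft_eq_root h hg u
    refine ⟨k + j, ?_⟩
    rw [Function.iterate_add_apply, hj, (iterate_graft_of_eq hh (hg.apply_root u) k).1, hk]

/-- The condition of `DescNonpos` outside the roots of a forest. -/
def ProperDescNonpos (g : V → V) (w : V → ℤ) : Prop :=
  ∀ v, g v ≠ v → ∑ u ∈ descendants g v, w u ≤ 0

/-- Below a non-root nothing changes under grafting, while the descendants of a root `v` are the
full trees hanging from the `h`-descendants of `v`. -/
lemma descNonpos_graft_iff (hg : IsForestMap g) (hh : ∀ v, g v = v → g (h v) = h v) (w : V → ℤ) :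
    DescNonpos (graft h g) w ↔ ProperDescNonpos g w ∧ DescNonpos h (hg.rootWeight w) := by
  have hroot : ∀ v, g v = v → ∑ u ∈ descendants (graft h g) v, w u =
      ∑ x ∈ descendants h v, hg.rootWeight w x := fun v hv => by
    rw [hg.sum_rootWeight]
    congr 1
    ext u
    rw [mem_descendants_graft_of_eq hg hh hv]
    simp
  constructor
  · intro hd
    refine ⟨fun v hv => descendants_graft_of_ne hh hv ▸ hd v, fun v => ?_⟩
    by_cases hv : g v = v
    · exact hroot v hv ▸ hd v
    -- Since `h` maps roots to roots, only non-roots lead to the non-root `v`, and their root weight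
    -- is zero.
    · refine le_of_eq (Finset.sum_eq_zero fun u hu => hg.rootWeight_of_ne w fun hgu => hv ?_)
      obtain ⟨k, hk⟩ := mem_descendants.1 hu
      exact hk ▸ (iterate_graft_of_eq hh hgu k).2
  · rintro ⟨h1, h2⟩ v
    by_cases hv : g v = v
    · rw [hroot v hv]
      exact h2 v
    · rw [descendants_graft_of_ne hh hv]
      exact h1 v hv

open Classical in
/-- The set of roots of a forest. -/
noncomputable def fixedFinset (g : V → V) : Finset V := {v | g v = v}

@[simp] lemma mem_fixedFinset {v : V} : v ∈ fixedFinset g ↔ g v = v := by simp [fixedFinset]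

/-- The forests satisfying the condition of `DescNonpos` outside their roots. -/
abbrev GoodForest (w : V → ℤ) : Type _ := {g : V → V // IsForestMap g ∧ ProperDescNonpos g w}

lemma exists_iterate_mem_periodicPts (f : V → V) (u : V) :
    ∃ k, f^[k] u ∈ Function.periodicPts f := by
  obtain ⟨m, n, hne, heq⟩ := Finite.exists_ne_map_eq_of_infinite fun n : ℕ => f^[n] u
  wlog hlt : m < n generalizing m n
  · exact this n m hne.symm heq.symm (lt_of_le_of_ne (not_lt.1 hlt) hne.symm)
  refine ⟨m, Function.mk_mem_periodicPts (Nat.sub_pos_of_lt hlt) ?_⟩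
  rw [Function.IsPeriodicPt, Function.IsFixedPt, ← Function.iterate_add_apply,
    Nat.sub_add_cancel hlt.le]
  exact heq.symm

lemma goodPerm_preserves {a : V → ℤ} (σ : GoodPerm (fixedFinset g) a) {v : V} (hv : g v = v) :
    g (σ.1 v) = σ.1 v := by
  by_contra hne
  have h1 := σ.2.1 (σ.1 v) (by simpa using hne)
  exact hne (by rw [σ.1.injective h1, hv])

/-- This recovers the roots from the grafted map, which makes the decomposition of a map unique. -/
lemma mem_periodicPts_graft_iff (hg : IsForestMap g) {a : V → ℤ} (σ : GoodPerm (fixedFinset g) a)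
    (v : V) : v ∈ Function.periodicPts (graft σ.1 g) ↔ g v = v := by
  have hh : ∀ v, g v = v → g (σ.1 v) = σ.1 v := fun v => goodPerm_preserves σ
  constructor
  · intro hv
    obtain ⟨n, hn, hper⟩ := Function.mem_periodicPts.1 hv
    obtain ⟨j, hj⟩ := exists_iterate_graft_eq_root σ.1 hg v
    -- After `j ≤ n * j` steps the orbit is at a root and from then on it stays among the roots; yet
    -- after `n * j` steps it is back at `v`.
    have h1 : (graft σ.1 g)^[n * j] v = v := hper.mul_const j
    have h2 : n * j = (n * j - j) + j := (Nat.sub_add_cancel (Nat.le_mul_of_pos_left j hn)).symm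
    rw [h2, Function.iterate_add_apply, hj] at h1
    have h3 := iterate_graft_of_eq hh (hg.apply_root v) (n * j - j)
    rw [← h3.1, h1] at h3
    exact h3.2
  · intro hv
    obtain ⟨n, hn, hper⟩ := Function.mem_periodicPts.1 (σ.1.injective.mem_periodicPts v)
    exact Function.mk_mem_periodicPts hn ((iterate_graft_of_eq hh hv n).1.trans hper)

/-- A map is a forest together with a permutation of its roots. -/
lemma nonempty_goodPerm_equiv (w : V → ℤ) :
    Nonempty ((Σ g : GoodForest w, GoodPerm (fixedFinset g.1) (g.2.1.rootWeight w)) ≃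
      {f : V → V // DescNonpos f w}) := by
  refine ⟨Equiv.ofBijective (fun p => ⟨graft p.2.1 p.1.1,
    (descNonpos_graft_iff p.1.2.1 (fun _ => goodPerm_preserves p.2) w).2 ⟨p.1.2.2, p.2.2.2⟩⟩)
    ⟨?_, ?_⟩⟩
  · rintro ⟨⟨g, hg, hp⟩, σ⟩ ⟨⟨g', hg', hp'⟩, σ'⟩ heq
    have hgraft : graft σ.1 g = graft σ'.1 g' := congrArg Subtype.val heq
    obtain rfl : g = g' := eq_of_graft_eq (fun v => by
      rw [← mem_periodicPts_graft_iff hg σ, hgraft, mem_periodicPts_graft_iff hg' σ']) hgraft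
    congr 1
    refine Subtype.ext (Equiv.ext fun v => ?_)
    by_cases hv : g v = v
    · rw [← graft_of_eq (h := σ.1) hv, hgraft, graft_of_eq hv]
    · rw [σ.2.1 v (by simpa using hv), σ'.2.1 v (by simpa using hv)]
  · rintro ⟨f, hf⟩
    classical
    set S := Function.periodicPts f with hS
    have hfix : ∀ v, f v = v → v ∈ S := fun v hv => Function.mk_mem_periodicPts one_pos hv
    have hbij := Function.bijOn_periodicPts f
    let τ : V → V := fun v => if v ∈ S then f v else v
    have hτS : ∀ v ∈ S, τ v = f v := fun v hv => if_pos hv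
    have hτ : Function.Injective τ := by
      intro u v huv
      by_cases hu : u ∈ S <;> by_cases hv : v ∈ S <;> simp only [τ, hu, hv, if_true, if_false] at huv
      · exact hbij.injOn hu hv huv
      · exact absurd (huv ▸ hbij.mapsTo hu) hv
      · exact absurd (huv ▸ hbij.mapsTo hv) hu
      · exact huv
    let σ : Equiv.Perm V := Equiv.ofBijective τ (Finite.injective_iff_bijective.1 hτ)
    have hg : IsForestMap (collapse f S) :=
      isForestMap_collapse fun u => exists_iterate_mem_periodicPts f u
    have hgraft : graft σ (collapse f S) = f := graft_collapse hfix hτS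
    have hh : ∀ v, collapse f S v = v → collapse f S (σ v) = σ v := fun v hv => by
      rw [collapse_eq_self_iff hfix] at hv ⊢
      change τ v ∈ S
      rw [hτS v hv]
      exact hbij.mapsTo hv
    have hd := (descNonpos_graft_iff hg hh w).1 (hgraft.symm ▸ hf)
    refine ⟨⟨⟨collapse f S, hg, hd.1⟩, ⟨σ, fun v hv => ?_, hd.2⟩⟩, Subtype.ext hgraft⟩
    rw [mem_fixedFinset, collapse_eq_self_iff hfix] at hv
    exact if_neg hv

lemma goodList_ne_nil [Nonempty V] (hg : IsForestMap g) {a : V → ℤ}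
    (L : GoodList (fixedFinset g) a) : L.1 ≠ [] := by
  inhabit V
  exact List.ne_nil_of_mem ((L.2.2.1 _).2 (mem_fixedFinset.2 (hg.apply_root default)))

variable [DecidableEq V]

lemma goodList_preserves {a : V → ℤ} (L : GoodList (fixedFinset g) a) {v : V} (hv : g v = v) :
    g (listSucc L.1 v) = listSucc L.1 v := by
  rw [← mem_fixedFinset, ← L.2.2.1]
  exact listSucc_mem ((L.2.2.1 v).2 (mem_fixedFinset.2 hv))

lemma isRay_graft {a : V → ℤ} (L : GoodList (fixedFinset g) a) :
    IsRay (graft (listSucc L.1) g) L.1 :=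
  (isRay_iff_eqOn L.2.1).2 fun x hx => graft_of_eq (mem_fixedFinset.1 ((L.2.2.1 x).1 hx))

lemma isTreeMap_graft [Nonempty V] (hg : IsForestMap g) {a : V → ℤ}
    (L : GoodList (fixedFinset g) a) : IsTreeMap (graft (listSucc L.1) g) := by
  have hmem : ∀ {x}, x ∈ L.1 ↔ g x = x := fun {x} => (L.2.2.1 x).trans mem_fixedFinset
  obtain ⟨r, hr, hrr, hk⟩ := exists_listSucc_eq_self L.2.1 (goodList_ne_nil hg L)
  refine ⟨r, (graft_of_eq (hmem.1 hr)).trans hrr, fun u => ?_⟩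
  obtain ⟨j, hj⟩ := exists_iterate_graft_eq_root (listSucc L.1) hg u
  obtain ⟨k, hk⟩ := hk _ (hmem.2 (hg.apply_root u))
  refine ⟨k + j, ?_⟩
  rw [Function.iterate_add_apply, hj,
    (iterate_graft_of_eq (fun _ => goodList_preserves L) (hg.apply_root u) k).1, hk]

lemma descNonpos_listSucc_iff (hg : IsForestMap g) (w : V → ℤ) {L : List V} (hn : L.Nodup)
    (hL : ∀ v, v ∈ L ↔ v ∈ fixedFinset g) :
    PartialSumsNonpos (hg.rootWeight w) 0 L ↔ DescNonpos (listSucc L) (hg.rootWeight w) :=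
  partialSumsNonpos_iff_descNonpos hn fun v hv =>
    hg.rootWeight_of_ne w fun e => hv ((hL v).2 (mem_fixedFinset.2 e))

/-- A tree with a marked vertex is a forest together with an enumeration of its roots, which
become the path from the marked vertex to the root of the tree. -/
lemma nonempty_goodList_equiv [Nonempty V] (w : V → ℤ) :
    Nonempty ((Σ g : GoodForest w, GoodList (fixedFinset g.1) (g.2.1.rootWeight w)) ≃
      {f : V → V // IsTreeMap f ∧ DescNonpos f w} × V) := by
  refine ⟨Equiv.ofBijective (fun p => (⟨graft (listSucc p.2.1) p.1.1,
    isTreeMap_graft p.1.2.1 p.2,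
    (descNonpos_graft_iff p.1.2.1 (fun _ => goodList_preserves p.2) w).2 ⟨p.1.2.2,
      (descNonpos_listSucc_iff p.1.2.1 w p.2.2.1 p.2.2.2.1).1 p.2.2.2.2⟩⟩,
    p.2.1.head (goodList_ne_nil p.1.2.1 p.2))) ⟨?_, ?_⟩⟩
  · rintro ⟨⟨g, hg, hp⟩, L⟩ ⟨⟨g', hg', hp'⟩, L'⟩ heq
    have hgraft : graft (listSucc L.1) g = graft (listSucc L'.1) g' :=
      congrArg (fun q => q.1.1) heq
    have hhead : L.1.head (goodList_ne_nil hg L) = L'.1.head (goodList_ne_nil hg' L') :=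
      congrArg Prod.snd heq
    -- The enumeration is the ray from the marked vertex, hence determined by the tree and the mark;
    -- its entries are the roots of the forest.
    have hLL : L.1 = L'.1 := (isRay_graft L).eq_of_head_eq (hgraft ▸ isRay_graft L') L.2.1 L'.2.1
      (by rw [List.head?_eq_some_head (goodList_ne_nil hg L),
        List.head?_eq_some_head (goodList_ne_nil hg' L'), hhead])
    obtain rfl : g = g' := eq_of_graft_eq (fun v => by
      rw [← mem_fixedFinset, ← L.2.2.1, hLL, L'.2.2.1, mem_fixedFinset]) hgraft
    congr 1
    exact Subtype.ext hLL
  · rintro ⟨⟨f, ⟨r, hr, hk⟩, hf⟩, v⟩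
    obtain ⟨k, hkv⟩ := hk v
    obtain ⟨L, hray, hn, hhead, hrL, -⟩ := exists_isRay hr k v hkv
    set S : Set V := {x | x ∈ L} with hS
    have hfix : ∀ x, f x = x → x ∈ S := fun x hx => by
      obtain ⟨k, hk⟩ := hk x
      rw [Function.iterate_fixed hx] at hk
      exact hk ▸ hrL
    have hLS : ∀ x ∈ S, listSucc L x = f x := fun x hx => ((isRay_iff_eqOn hn).1 hray x hx).symm
    have hg : IsForestMap (collapse f S) :=
      isForestMap_collapse fun u => by
        obtain ⟨k, hk⟩ := hk u
        exact ⟨k, hk.symm ▸ hrL⟩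
    have hgraft : graft (listSucc L) (collapse f S) = f := graft_collapse hfix hLS
    have hmem : ∀ x, x ∈ L ↔ x ∈ fixedFinset (collapse f S) := fun x => by
      rw [mem_fixedFinset, collapse_eq_self_iff hfix]; rfl
    have hh : ∀ x, collapse f S x = x → collapse f S (listSucc L x) = listSucc L x := fun x hx => by
      rw [collapse_eq_self_iff hfix] at hx ⊢
      exact listSucc_mem hx
    have hd := (descNonpos_graft_iff hg hh w).1 (hgraft.symm ▸ hf)
    refine ⟨⟨⟨collapse f S, hg, hd.1⟩, ⟨L, hn, hmem, (descNonpos_listSucc_iff hg w hn hmem).2 hd.2⟩⟩,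
      Prod.ext (Subtype.ext hgraft) ?_⟩
    exact Option.some_injective _ ((List.head?_eq_some_head _).symm.trans hhead)

/-- For weights of total zero, marking a vertex turns trees into maps. -/
theorem card_mul_card_isTreeMap [Nonempty V] (w : V → ℤ) (hw : ∑ v, w v = 0) :
    Fintype.card V * Nat.card {f : V → V // IsTreeMap f ∧ DescNonpos f w} =
      Nat.card {f : V → V // DescNonpos f w} := by
  have hfib : ∀ g : GoodForest w, Nonempty (GoodList (fixedFinset g.1) (g.2.1.rootWeight w) ≃
      GoodPerm (fixedFinset g.1) (g.2.1.rootWeight w)) := fun g =>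
    nonempty_goodList_equiv_goodPerm _ _
      (fun v hv => g.2.1.rootWeight_of_ne w (by simpa using hv))
      (by rw [g.2.1.sum_univ_rootWeight, hw])
  obtain ⟨e₁⟩ := nonempty_goodList_equiv w
  obtain ⟨e₂⟩ := nonempty_goodPerm_equiv w
  rw [← Nat.card_congr (e₁.symm.trans ((Equiv.sigmaCongrRight fun g => (hfib g).some).trans e₂)),
    Nat.card_prod, Nat.card_eq_fintype_card (α := V), mul_comm]

end Forests

end DigraphParking

theorem mainTheorem2 (n : ℕ) (hn : 1 ≤ n) :
    n * DigraphParking.sourceTreeTotal n n = DigraphParking.inverseMappingTotal n n := by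
  have : Nonempty (Fin n) := ⟨⟨0, hn⟩⟩
  rw [DigraphParking.sourceTreeTotal_eq_sum, DigraphParking.inverseMappingTotal_eq_sum,
    Finset.mul_sum]
  refine Finset.sum_congr rfl fun s _ => ?_
  -- This is where the number of drivers must equal the number of vertices.
  have hw : ∑ v, DigraphParking.excess s v = 0 := by
    rw [DigraphParking.sum_excess]; simp
  simpa using DigraphParking.card_mul_card_isTreeMap _ hw
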